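/- For a bit string ${\bf x}\in\{0,1\}^m$ and $q\in(0,1)$, a trace of ${\bf x}$ is the random string obtained by deleting each bit of ${\bf x}$ independently with probability $q$ and concatenating the retained bits in order. Let $\mathcal S=\bigcup_{k\ge 0}\{0,1\}^k$. We say that $T$ traces suffice to distinguish between ${\bf x},{\bf y}\in\{0,1\}^m$ with probability at least $1-\varepsilon$ if there is a function $G\colon\mathcal S^T\to\{0,1\}^m$ such that $\mathbb P[G(\mathfrak X)={\bf x}]\ge 1-\varepsilon$ when $\mathfrak X$ consists of $T$ independent traces of ${\bf x}$, and $\mathbb P[G(\mathfrak Y)={\bf y}]\ge 1-\varepsilon$ when $\mathfrak Y$ consists of $T$ independent traces of ${\bf y}$. For $n\ge 1$ let ${\bf x}_n:=(01)^{n-1}\,10\,(01)^n$ and ${\bf y}_n:=(01)^n\,10\,(01)^{n-1}$, both in $\{0,1\}^{4n}$. For every $q\in(0,1)$ there is a constant $C>0$ such that for all $\varepsilon\in(0,1/2)$ and all integers $n\ge 2$, $\lceil C\log(1/\varepsilon)\,n^{3/2}\log n\rceil$ traces suffice to distinguish between ${\bf x}_n$ and ${\bf y}_n$ with probability at least $1-\varepsilon$.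 -/

import Mathlib

namespace TraceReconstruction

open MeasureTheory ProbabilityTheory

/-- Bit strings of length `n`; `false` is the bit `0` and `true` is the bit `1`. -/
abbrev BitString (n : ℕ) : Type := Fin n → Bool

/-- The countable set of bit strings of finite length carries the discrete σ-algebra. -/
instance instMeasurableSpaceListBool : MeasurableSpace (List Bool) := ⊤

instance instDiscreteMeasurableSpaceListBool : DiscreteMeasurableSpace (List Bool) :=
  ⟨fun _ => trivial⟩

/-- The contracted string obtained from `x` when exactly the bits at the positions `k` with
`keep k = true` are retained (copied in order), the others being deleted. -/
def contract {n : ℕ} (x : BitString n) (keep : Fin n → Bool) : List Bool :=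
  ((List.finRange n).filter keep).map x

/-- The law of the retention pattern of the deletion channel with deletion probability `q`: each of
the `n` bits is independently retained with probability `1 - q` and deleted with
probability `q`. -/
noncomputable def patternLaw (q : unitInterval) (n : ℕ) : Measure (Fin n → Bool) :=
  Measure.pi fun _ => bernoulliMeasure true false (unitInterval.symm q)

/-- The law of a trace of `x`: the output of the deletion channel with deletion
probability `q` applied to `x`. -/
noncomputable def traceLaw (q : unitInterval) {n : ℕ} (x : BitString n) : Measure (List Bool) :=
  (patternLaw q n).map (contract x)

instance instIsProbabilityMeasureTraceLaw (q : unitInterval) {n : ℕ} (x : BitString n) :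
    IsProbabilityMeasure (traceLaw q x) := by
  unfold traceLaw patternLaw
  exact Measure.isProbabilityMeasure_map (measurable_of_countable _).aemeasurable

/-- The joint law of `T` independent traces of `x`. -/
noncomputable def tracesLaw (q : unitInterval) {n : ℕ} (x : BitString n) (T : ℕ) :
    Measure (Fin T → List Bool) :=
  Measure.pi fun _ => traceLaw q x

/-- The strings `x` and `y` can be distinguished with probability at least `1 - ε` from `T` traces
of the deletion channel with deletion probability `q`. -/
def CanDistinguish (q : unitInterval) {n : ℕ} (x y : BitString n) (T : ℕ) (ε : ℝ) : Prop :=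
  ∃ G : (Fin T → List Bool) → BitString n,
    1 - ε ≤ (tracesLaw q x T).real {X | G X = x} ∧ 1 - ε ≤ (tracesLaw q y T).real {X | G X = y}

/-- The string `(01)^a 10 (01)^b`. -/
def defectList (a b : ℕ) : List Bool :=
  (List.replicate a [false, true]).flatten ++ [true, false] ++
    (List.replicate b [false, true]).flatten

theorem length_defectList (a b : ℕ) : (defectList a b).length = 2 * a + 2 + 2 * b := by
  simp [defectList]
  omega

/-- The string `(01)^(n-1) 10 (01)^n` of length `4 * n`. -/
def xString (n : ℕ) (hn : 1 ≤ n) : BitString (4 * n) := fun i =>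
  (defectList (n - 1) n).get (i.cast (by rw [length_defectList]; omega))

/-- The string `(01)^n 10 (01)^(n-1)` of length `4 * n`. -/
def yString (n : ℕ) (hn : 1 ≤ n) : BitString (4 * n) := fun i =>
  (defectList n (n - 1)).get (i.cast (by rw [length_defectList]; omega))

end TraceReconstruction

namespace TraceReconstruction

open MeasureTheory ProbabilityTheory

/-! The test statistic is a weighted sum of products of signs of consecutive trace bits. In a trace
of an alternating string such a product has mean `-(1 - q) / (1 + q)`, so after centring only pairs
starting at or before the defect have a bias, and this bias decays geometrically with the distance
to the defect (`nextMean_defectList`).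

The weight `φ` is a tent of half-width `L` of order `√n`, the scale on which the trace position of
the defect fluctuates, with the middle of its rising side at `2 n (1 - q)`. Moving the defect by two
positions moves it by `2 (1 - q)` on average in the trace. As `φ` has slope one there, the mean
changes by at least the constant `(1 - q) ^ 4` (`drift_defectList_sub_ge`). Since the total bias is
bounded, the second moment is of order `L * ∑ φ k`, that is `L ^ 3` or `n ^ (3 / 2)`
(`traceExp_sq_pairStat_le`).

A mean gap `δ` with second moments at most `V` forces the Bhattacharyya coefficient `ρ` of the two
trace laws to satisfy `1 - ρ ≥ δ ^ 2 / (8 * V)`. The likelihood ratio test on `T` traces errs with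
probability at most `ρ ^ T` (`canDistinguish_of_statistic`). The finitely many small `n` are handled
by the event that no bit is deleted. -/

/-! ### Expectations over a trace. -/

/-- The sign `±1` of a bit. -/
def bitSign (b : Bool) : ℝ := if b then 1 else -1

theorem bitSign_true : bitSign true = 1 := rfl

theorem bitSign_false : bitSign false = -1 := rfl

theorem abs_bitSign (b : Bool) : |bitSign b| = 1 := by cases b <;> simp [bitSign]

/-- The expectation of `F` over a trace of the bit list `l`, by recursion on `l`. -/
def traceExp (q : ℝ) : List Bool → (List Bool → ℝ) → ℝ
  | [], F => F []
  | b :: l, F => q * traceExp q l F + (1 - q) * traceExp q l (fun t => F (b :: t))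

theorem traceExp_add (q : ℝ) (l : List Bool) (F G : List Bool → ℝ) :
    traceExp q l (fun t => F t + G t) = traceExp q l F + traceExp q l G := by
  induction l generalizing F G with
  | nil => rfl
  | cons b l ih => simp only [traceExp, ih]; ring

theorem traceExp_const_mul (q c : ℝ) (l : List Bool) (F : List Bool → ℝ) :
    traceExp q l (fun t => c * F t) = c * traceExp q l F := by
  induction l generalizing F with
  | nil => rfl
  | cons b l ih => simp only [traceExp, ih]; ring

theorem traceExp_const (q c : ℝ) (l : List Bool) : traceExp q l (fun _ => c) = c := by
  induction l with
  | nil => rfl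
  | cons b l ih => simp only [traceExp, ih]; ring

theorem traceExp_nonneg {q : ℝ} (h0 : 0 ≤ q) (h1 : q ≤ 1) (l : List Bool) {F : List Bool → ℝ}
    (hF : ∀ t, 0 ≤ F t) : 0 ≤ traceExp q l F := by
  induction l generalizing F with
  | nil => exact hF _
  | cons b l ih =>
    exact add_nonneg (mul_nonneg h0 (ih hF)) (mul_nonneg (by linarith) (ih fun t => hF _))

theorem traceExp_eq_zero_of_sublist (q : ℝ) (l : List Bool) {F : List Bool → ℝ}
    (hF : ∀ t, t.Sublist l → F t = 0) : traceExp q l F = 0 := by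
  induction l generalizing F with
  | nil => exact hF _ (List.Sublist.refl _)
  | cons b l ih =>
    simp only [traceExp]
    rw [ih fun t ht => hF t (ht.cons b), ih fun t ht => hF _ (ht.cons_cons b)]
    ring

theorem pow_length_le_traceExp_indicator {q : ℝ} (h0 : 0 ≤ q) (h1 : q ≤ 1) (l : List Bool) :
    (1 - q) ^ l.length ≤ traceExp q l (fun t => if t = l then 1 else 0) := by
  induction l with
  | nil => simp [traceExp]
  | cons b l ih =>
    have h2 : 0 ≤ traceExp q l (fun t => if t = b :: l then 1 else 0) :=
      traceExp_nonneg h0 h1 l fun t => by split_ifs <;> norm_num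
    have h3 := mul_le_mul_of_nonneg_left ih (sub_nonneg.2 h1)
    simp only [traceExp, List.cons.injEq, true_and, List.length_cons, pow_succ']
    linarith [mul_nonneg h0 h2]

/-! ### The pair statistic: mean and second moment. -/

/-- The mean sign of the next retained bit when `l` remains to be transmitted and is continued by
an infinite alternating string starting with `0`. -/
noncomputable def nextMean (q : ℝ) : List Bool → ℝ
  | [] => -((1 - q) / (1 + q))
  | b :: l => (1 - q) * bitSign b + q * nextMean q l

/-- The centred sum of `φ k` times the product of the signs of the `k`-th and `(k+1)`-st bits of a
trace, of which the part from the `(k+1)`-st bit on is given, `s` being the sign of the `k`-th. -/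
noncomputable def pairStat (q : ℝ) (φ : ℕ → ℝ) : ℕ → ℝ → List Bool → ℝ
  | k, s, [] => φ k * (s * -((1 - q) / (1 + q)) + (1 - q) / (1 + q))
  | k, s, b :: t => φ k * (s * bitSign b + (1 - q) / (1 + q)) + pairStat q φ (k + 1) (bitSign b) t

/-- One step of the lazy walk that moves up with probability `1 - q`, acting on functions. -/
noncomputable def lazyStep (q : ℝ) : Module.End ℝ (ℕ → ℝ) where
  toFun g := fun k => q * g k + (1 - q) * g (k + 1)
  map_add' g h := by ext k; simp; ring
  map_smul' c g := by ext k; simp; ring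

theorem lazyStep_apply (q : ℝ) (g : ℕ → ℝ) (k : ℕ) :
    lazyStep q g k = q * g k + (1 - q) * g (k + 1) := rfl

/-- The bias of the pair formed by the bit `b` and the next retained bit of `l`. -/
noncomputable def pairBias (q : ℝ) (b : Bool) (l : List Bool) : ℝ :=
  bitSign b * nextMean q l + (1 - q) / (1 + q)

/-- The expected contribution to `pairStat` of the bits of `l`, when `k` bits were retained. -/
noncomputable def drift (q : ℝ) (φ : ℕ → ℝ) : List Bool → ℕ → ℝ
  | [] => 0
  | b :: l => lazyStep q (drift q φ l) + ((1 - q) * pairBias q b l) • fun k => φ (k + 1)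

/-- The total absolute bias of the pairs of `l`. -/
noncomputable def driftMass (q : ℝ) : List Bool → ℝ
  | [] => 0
  | b :: l => |pairBias q b l| + driftMass q l

theorem driftMass_nonneg (q : ℝ) (l : List Bool) : 0 ≤ driftMass q l := by
  induction l with
  | nil => exact le_rfl
  | cons b l ih => exact add_nonneg (abs_nonneg _) ih

/-- The pair already open at rank `k` closes with mean sign `nextMean`. A bit retained at rank `k +
1` opens a pair of weight `φ (k + 1)` and mean `pairBias`, and the rank itself performs the lazy
walk. -/
theorem traceExp_pairStat (q : ℝ) (φ : ℕ → ℝ) (l : List Bool) (k : ℕ) (s : ℝ) :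
    traceExp q l (pairStat q φ k s)
      = φ k * (s * nextMean q l + (1 - q) / (1 + q)) + drift q φ l k := by
  induction l generalizing k s with
  | nil => simp [traceExp, pairStat, nextMean, drift]
  | cons b l ih =>
    simp only [traceExp, pairStat, traceExp_add, traceExp_const, ih, nextMean, drift, pairBias,
      Pi.add_apply, Pi.smul_apply, lazyStep_apply, smul_eq_mul]
    ring

theorem abs_drift_le {q : ℝ} (h0 : 0 ≤ q) (h1 : q ≤ 1) {φ : ℕ → ℝ} {L : ℝ}
    (hφ : ∀ k, |φ k| ≤ L) (l : List Bool) (k : ℕ) : |drift q φ l k| ≤ L * driftMass q l := by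
  induction l generalizing k with
  | nil => simp [drift, driftMass]
  | cons b l ih =>
    have hL : 0 ≤ L := (abs_nonneg _).trans (hφ 0)
    simp only [drift, driftMass, Pi.add_apply, Pi.smul_apply, lazyStep_apply, smul_eq_mul]
    have h2 : |(1 - q) * pairBias q b l * φ (k + 1)| ≤ |pairBias q b l| * L := by
      rw [abs_mul, abs_mul, abs_of_nonneg (sub_nonneg.2 h1)]
      refine mul_le_mul ?_ (hφ _) (abs_nonneg _) (abs_nonneg _)
      exact mul_le_of_le_one_left (abs_nonneg _) (by linarith)
    have h3 : |q * drift q φ l k| ≤ q * (L * driftMass q l) := by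
      rw [abs_mul, abs_of_nonneg h0]; exact mul_le_mul_of_nonneg_left (ih _) h0
    have h4 : |(1 - q) * drift q φ l (k + 1)| ≤ (1 - q) * (L * driftMass q l) := by
      rw [abs_mul, abs_of_nonneg (sub_nonneg.2 h1)]
      exact mul_le_mul_of_nonneg_left (ih _) (sub_nonneg.2 h1)
    exact (abs_add_three _ _ _).trans (by linarith)

theorem retentionRatio_mem {q : ℝ} (h0 : 0 ≤ q) (h1 : q ≤ 1) :
    0 ≤ (1 - q) / (1 + q) ∧ (1 - q) / (1 + q) ≤ 1 := by
  refine ⟨div_nonneg (by linarith) (by linarith), ?_⟩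
  rw [div_le_one (by linarith)]; linarith

theorem abs_nextMean_le {q : ℝ} (h0 : 0 ≤ q) (h1 : q ≤ 1) (l : List Bool) :
    |nextMean q l| ≤ 1 := by
  induction l with
  | nil =>
    have := retentionRatio_mem h0 h1
    simp only [nextMean, abs_neg]
    rw [abs_of_nonneg this.1]; exact this.2
  | cons b l ih =>
    simp only [nextMean]
    calc _ ≤ |(1 - q) * bitSign b| + |q * nextMean q l| := abs_add_le _ _
      _ = (1 - q) * 1 + q * |nextMean q l| := by
        rw [abs_mul, abs_mul, abs_bitSign, abs_of_nonneg h0, abs_of_nonneg (sub_nonneg.2 h1)]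
      _ ≤ 1 := by nlinarith

theorem abs_mul_add_retentionRatio_le {q : ℝ} (h0 : 0 ≤ q) (h1 : q ≤ 1) {s u : ℝ} (hs : |s| ≤ 1)
    (hu : |u| ≤ 1) : |s * u + (1 - q) / (1 + q)| ≤ 2 := by
  have := retentionRatio_mem h0 h1
  calc _ ≤ |s * u| + |(1 - q) / (1 + q)| := abs_add_le _ _
    _ ≤ 1 + 1 := by
      rw [abs_mul, abs_of_nonneg this.1]
      exact add_le_add (mul_le_one₀ hs (abs_nonneg _) hu) this.2
    _ = 2 := by norm_num

/-- Peel off the first pair term `c`. Its square costs `4 * L * φ k` and the cross term with the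
remainder costs `(8 + 4 * m) * L * φ k`; `G` accumulates these costs over the ranks. -/
theorem traceExp_sq_pairStat_le {q : ℝ} (h0 : 0 ≤ q) (h1 : q ≤ 1) {φ G : ℕ → ℝ} {L m : ℝ}
    (hφ0 : ∀ k, 0 ≤ φ k) (hφL : ∀ k, φ k ≤ L) (hG0 : ∀ k, 0 ≤ G k)
    (hG : ∀ k, G k = (12 + 4 * m) * L * φ k + G (k + 1)) (l : List Bool) (hm : driftMass q l ≤ m)
    (k : ℕ) (s : ℝ) (hs : |s| ≤ 1) :
    traceExp q l (fun t => pairStat q φ k s t ^ 2) ≤ G k := by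
  have hL : 0 ≤ L := (hφ0 0).trans (hφL 0)
  have hφabs : ∀ k, |φ k| ≤ L := fun k => by rw [abs_of_nonneg (hφ0 k)]; exact hφL k
  have hm0 : 0 ≤ m := (driftMass_nonneg q l).trans hm
  have hsq : ∀ (k : ℕ) (u : ℝ), |u| ≤ 2 → (φ k * u) ^ 2 ≤ 4 * L * φ k := fun k u hu => by
    have h2 : u ^ 2 ≤ 4 := by
      have := sq_le_sq' (by linarith [abs_nonneg u]) hu
      rw [sq_abs] at this; linarith
    have h3 : φ k ^ 2 ≤ L * φ k := by
      rw [sq]; exact mul_le_mul_of_nonneg_right (hφL k) (hφ0 k)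
    rw [mul_pow]
    calc _ ≤ φ k ^ 2 * 4 := mul_le_mul_of_nonneg_left h2 (sq_nonneg _)
      _ ≤ _ := by linarith
  induction l generalizing k s with
  | nil =>
    have h2 := hsq k _ (abs_mul_add_retentionRatio_le h0 h1 hs (abs_nextMean_le h0 h1 []))
    have h3 : 0 ≤ (8 + 4 * m) * L * φ k := by have := hφ0 k; positivity
    simp only [traceExp, pairStat]
    simp only [nextMean] at h2
    rw [hG]
    linarith [hG0 (k + 1)]
  | cons b l ih =>
    simp only [driftMass] at hm
    have hml : driftMass q l ≤ m := by linarith [abs_nonneg (pairBias q b l)]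
    have hb : |bitSign b| ≤ 1 := (abs_bitSign b).le
    set c := φ k * (s * bitSign b + (1 - q) / (1 + q)) with hc
    -- However many terms remain, their mean is `O(L)`, because the biases have total mass at most
    -- `m`. This plays the role of decorrelation.
    have hA : |traceExp q l (pairStat q φ (k + 1) (bitSign b))| ≤ (2 + m) * L := by
      rw [traceExp_pairStat]
      calc _ ≤ _ := abs_add_le _ _
        _ ≤ L * 2 + L * driftMass q l := by
          refine add_le_add ?_ (abs_drift_le h0 h1 hφabs l _)
          rw [abs_mul]
          exact mul_le_mul (hφabs _)
            (abs_mul_add_retentionRatio_le h0 h1 hb (abs_nextMean_le h0 h1 l)) (abs_nonneg _) hL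
        _ ≤ _ := by nlinarith
    have hcabs : |c| ≤ 2 * φ k := by
      rw [hc, abs_mul, abs_of_nonneg (hφ0 k), mul_comm]
      exact mul_le_mul_of_nonneg_right (abs_mul_add_retentionRatio_le h0 h1 hs hb) (hφ0 k)
    have hcA : c * traceExp q l (pairStat q φ (k + 1) (bitSign b)) ≤ 2 * φ k * ((2 + m) * L) := by
      refine (le_abs_self _).trans ?_
      rw [abs_mul]
      exact mul_le_mul hcabs hA (abs_nonneg _) (by linarith [hφ0 k])
    have hc2 : c ^ 2 ≤ 4 * L * φ k := hsq k _ (abs_mul_add_retentionRatio_le h0 h1 hs hb)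
    have hexp : traceExp q l (fun t => pairStat q φ k s (b :: t) ^ 2)
        = c ^ 2 + 2 * c * traceExp q l (pairStat q φ (k + 1) (bitSign b))
          + traceExp q l (fun t => pairStat q φ (k + 1) (bitSign b) t ^ 2) := by
      rw [← traceExp_const_mul, ← traceExp_const q (c ^ 2) l, ← traceExp_add, ← traceExp_add]
      congr 1; ext t
      simp only [pairStat]
      ring
    have h2 : traceExp q l (fun t => pairStat q φ k s (b :: t) ^ 2) ≤ G k := by
      rw [hexp, hG]
      linarith [ih hml (k + 1) (bitSign b) hb]
    simp only [traceExp]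
    nlinarith [mul_le_mul_of_nonneg_left (ih hml k s hs) h0,
      mul_le_mul_of_nonneg_left h2 (sub_nonneg.2 h1)]

/-! ### From a mean gap to a likelihood ratio test. -/

/-- Factor `P - Q` as `(√P - √Q) * (√P + √Q)` and apply Cauchy–Schwarz; the first factor produces
the squared Hellinger distance. -/
theorem sq_sum_mul_sub_le {ι : Type*} (S : Finset ι) (P Q f : ι → ℝ) (hP : ∀ t, 0 ≤ P t)
    (hQ : ∀ t, 0 ≤ Q t) (hP1 : ∑ t ∈ S, P t = 1) (hQ1 : ∑ t ∈ S, Q t = 1) :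
    (∑ t ∈ S, P t * f t - ∑ t ∈ S, Q t * f t) ^ 2
      ≤ (1 - ∑ t ∈ S, √(P t * Q t)) *
        (4 * (∑ t ∈ S, P t * f t ^ 2 + ∑ t ∈ S, Q t * f t ^ 2)) := by
  have h1 : ∑ t ∈ S, P t * f t - ∑ t ∈ S, Q t * f t
      = ∑ t ∈ S, (√(P t) - √(Q t)) * ((√(P t) + √(Q t)) * f t) := by
    rw [← Finset.sum_sub_distrib]
    refine Finset.sum_congr rfl fun t _ => ?_
    linear_combination (-f t) * Real.sq_sqrt (hP t) + f t * Real.sq_sqrt (hQ t)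
  have h2 : ∑ t ∈ S, (√(P t) - √(Q t)) ^ 2 = 2 * (1 - ∑ t ∈ S, √(P t * Q t)) := by
    have : ∀ t ∈ S, (√(P t) - √(Q t)) ^ 2 = P t + Q t - 2 * √(P t * Q t) := fun t _ => by
      rw [sub_sq, Real.sq_sqrt (hP t), Real.sq_sqrt (hQ t), Real.sqrt_mul (hP t)]; ring
    rw [Finset.sum_congr rfl this, Finset.sum_sub_distrib, Finset.sum_add_distrib, hP1, hQ1,
      ← Finset.mul_sum]
    ring
  have h3 : ∑ t ∈ S, ((√(P t) + √(Q t)) * f t) ^ 2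
      ≤ 2 * (∑ t ∈ S, P t * f t ^ 2 + ∑ t ∈ S, Q t * f t ^ 2) := by
    rw [← Finset.sum_add_distrib, Finset.mul_sum]
    refine Finset.sum_le_sum fun t _ => ?_
    have h4 : (√(P t) + √(Q t)) ^ 2 ≤ 2 * (P t + Q t) := by
      nlinarith [sq_nonneg (√(P t) - √(Q t)), Real.sq_sqrt (hP t), Real.sq_sqrt (hQ t)]
    rw [mul_pow]
    nlinarith [mul_le_mul_of_nonneg_right h4 (sq_nonneg (f t))]
  have h5 : 0 ≤ ∑ t ∈ S, (√(P t) - √(Q t)) ^ 2 := Finset.sum_nonneg fun t _ => sq_nonneg _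
  rw [h1]
  refine (Finset.sum_mul_sq_le_sq_mul_sq _ _ _).trans ?_
  refine (mul_le_mul_of_nonneg_left h3 h5).trans ?_
  rw [h2]
  apply le_of_eq; ring

theorem integral_patternLaw (q : unitInterval) (n : ℕ) (F : (Fin n → Bool) → ℝ) :
    ∫ w, F w ∂patternLaw q n
      = ∑ w, (∏ i, (if w i then 1 - (q : ℝ) else q)) * F w := by
  rw [patternLaw, integral_fintype .of_finite]
  refine Finset.sum_congr rfl fun w _ => ?_
  rw [smul_eq_mul, measureReal_def, Measure.pi_singleton, ENNReal.toReal_prod]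
  congr 1
  refine Finset.prod_congr rfl fun i _ => ?_
  rw [← measureReal_def, bernoulliMeasure_real_apply _ (measurableSet_singleton _)]
  cases w i <;> simp

theorem contract_cons {n : ℕ} (x : BitString (n + 1)) (b : Bool) (w : Fin n → Bool) :
    contract x (Fin.cons b w)
      = if b then x 0 :: contract (fun i => x i.succ) w else contract (fun i => x i.succ) w := by
  simp only [contract, List.finRange_succ, List.filter_cons, Fin.cons_zero, List.filter_map]
  cases b <;> simp [Function.comp_def]

theorem sum_pattern_eq_traceExp (q : ℝ) {n : ℕ} (x : BitString n) (F : List Bool → ℝ) :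
    ∑ w : Fin n → Bool, (∏ i, (if w i then 1 - q else q)) * F (contract x w)
      = traceExp q (List.ofFn x) F := by
  induction n generalizing F with
  | zero => simp [contract, traceExp]
  | succ n ih =>
    have hc : ∀ (b : Bool) (w : Fin n → Bool),
        (Fin.consEquiv fun _ : Fin (n + 1) => Bool) (b, w) = Fin.cons b w := fun _ _ => rfl
    rw [← (Fin.consEquiv fun _ : Fin (n + 1) => Bool).sum_comp, Fintype.sum_prod_type]
    simp only [hc, contract_cons, Fin.prod_univ_succ, Fin.cons_zero,
      Fin.cons_succ, Fintype.sum_bool, List.ofFn_succ, traceExp]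
    rw [← ih (fun i => x i.succ) F, ← ih (fun i => x i.succ) (fun t => F (x 0 :: t)),
      Finset.mul_sum, Finset.mul_sum, add_comm]
    simp [mul_assoc]

theorem integral_traceLaw (q : unitInterval) {n : ℕ} (x : BitString n) (F : List Bool → ℝ) :
    ∫ t, F t ∂traceLaw q x = traceExp q (List.ofFn x) F := by
  rw [traceLaw, integral_map (measurable_of_countable _).aemeasurable
    (measurable_of_countable F).aestronglyMeasurable, integral_patternLaw,
    sum_pattern_eq_traceExp]

theorem traceLaw_compl_eq_zero (q : unitInterval) {n : ℕ} (x : BitString n)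
    (S : Finset (List Bool)) (hS : ∀ w, contract x w ∈ S) : traceLaw q x (S : Set _)ᶜ = 0 := by
  rw [traceLaw, Measure.map_apply (measurable_of_countable _) (by trivial)]
  convert measure_empty (μ := patternLaw q n)
  ext w; simp [hS w]

theorem sum_traceLaw_mul (q : unitInterval) {n : ℕ} (x : BitString n) (S : Finset (List Bool))
    (hS : ∀ w, contract x w ∈ S) (F : List Bool → ℝ) :
    ∑ t ∈ S, (traceLaw q x).real {t} * F t = traceExp q (List.ofFn x) F := by
  have h0 : ∀ᵐ t ∂traceLaw q x, t ∈ (S : Set (List Bool)) := traceLaw_compl_eq_zero q x S hS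
  rw [← integral_traceLaw, ← setIntegral_eq_integral_of_ae_compl_eq_zero (s := (S : Set _)),
    setIntegral_finset S (IntegrableOn.finset)]
  · rfl
  · filter_upwards [h0] with t ht h using absurd ht h

theorem measureReal_ne_le_sum (q : unitInterval) {n T : ℕ} (x : BitString n)
    (S : Finset (List Bool)) (hS : ∀ w, contract x w ∈ S) (A : Set (Fin T → List Bool))
    [DecidablePred (· ∈ A)] :
    1 - (tracesLaw q x T).real A
      ≤ ∑ X ∈ (Fintype.piFinset fun _ : Fin T => S) with X ∉ A,
        ∏ i, (traceLaw q x).real {X i} := by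
  have : IsProbabilityMeasure (tracesLaw q x T) := by unfold tracesLaw; infer_instance
  have h0 : ∀ᵐ X ∂tracesLaw q x T, ∀ i, X i ∈ S := by
    rw [ae_all_iff]
    intro i
    have := (measurePreserving_eval (fun _ : Fin T => traceLaw q x) i).quasiMeasurePreserving.ae
      (p := fun t => t ∈ S) (traceLaw_compl_eq_zero q x S hS)
    exact this
  have hm : MeasurableSet A := A.to_countable.measurableSet
  rw [← probReal_compl_eq_one_sub hm]
  have h1 : (tracesLaw q x T).real Aᶜ ≤ (tracesLaw q x T).real
      (((Fintype.piFinset fun _ : Fin T => S).filter (· ∉ A) : Finset _) : Set _) := by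
    refine ENNReal.toReal_mono (measure_ne_top _ _) (measure_mono_ae ?_)
    filter_upwards [h0] with X hX hXA
    exact Finset.mem_coe.2 (Finset.mem_filter.2 ⟨Fintype.mem_piFinset.2 hX, hXA⟩)
  refine h1.trans (le_of_eq ?_)
  rw [← sum_measureReal_singleton]
  refine Finset.sum_congr rfl fun X _ => ?_
  rw [measureReal_def, tracesLaw, Measure.pi_singleton, ENNReal.toReal_prod]
  rfl

/-- The likelihood ratio test succeeds as soon as the `T`-th power of the Bhattacharyya coefficient
is small. -/
theorem canDistinguish_of_pow_le (q : unitInterval) {n : ℕ} (x y : BitString n) (T : ℕ) (ε : ℝ)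
    (S : Finset (List Bool)) (hx : ∀ w, contract x w ∈ S) (hy : ∀ w, contract y w ∈ S)
    (h : (∑ t ∈ S, √((traceLaw q x).real {t} * (traceLaw q y).real {t})) ^ T ≤ ε) :
    CanDistinguish q x y T ε := by
  classical
  set P : (Fin T → List Bool) → ℝ := fun X => ∏ i, (traceLaw q x).real {X i} with hP
  set Q : (Fin T → List Bool) → ℝ := fun X => ∏ i, (traceLaw q y).real {X i} with hQ
  have hP0 : ∀ X, 0 ≤ P X := fun X => Finset.prod_nonneg fun i _ => measureReal_nonneg
  have hQ0 : ∀ X, 0 ≤ Q X := fun X => Finset.prod_nonneg fun i _ => measureReal_nonneg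
  -- The Bhattacharyya coefficient is multiplicative over independent traces.
  have hsum : ∑ X ∈ Fintype.piFinset fun _ : Fin T => S, √(P X * Q X) ≤ ε := by
    refine le_trans (le_of_eq ?_) h
    have hprod := Finset.sum_prod_piFinset S fun (_ : Fin T) t =>
      √((traceLaw q x).real {t} * (traceLaw q y).real {t})
    rw [Finset.prod_const, Finset.card_univ, Fintype.card_fin] at hprod
    rw [← hprod]
    refine Finset.sum_congr rfl fun X _ => ?_
    rw [hP, hQ, ← Finset.prod_mul_distrib, Real.sqrt_prod]
    exact fun i _ => mul_nonneg measureReal_nonneg measureReal_nonneg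
  have herr : ∀ (R : (Fin T → List Bool) → ℝ) (A : Set (Fin T → List Bool))
      [DecidablePred (· ∈ A)], (∀ X, X ∉ A → R X ≤ √(P X * Q X)) →
      ∑ X ∈ (Fintype.piFinset fun _ : Fin T => S) with X ∉ A, R X ≤ ε := fun R A _ hR => by
    refine le_trans (Finset.sum_le_sum fun X hX => hR X (Finset.mem_filter.1 hX).2) ?_
    refine le_trans (Finset.sum_le_sum_of_subset_of_nonneg (Finset.filter_subset _ _) ?_) hsum
    exact fun X _ _ => Real.sqrt_nonneg _
  refine ⟨fun X => if Q X ≤ P X then x else y, ?_, ?_⟩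
  · have h1 := measureReal_ne_le_sum q x S hx {X | (if Q X ≤ P X then x else y) = x}
    have h2 := herr P {X | (if Q X ≤ P X then x else y) = x} fun X hX => by
      -- An error under `x` requires `P X < Q X`, whence `P X ≤ √(P X * Q X)`.
      have h3 : ¬ Q X ≤ P X := fun h3 => hX (by simp [h3])
      refine Real.le_sqrt_of_sq_le ?_
      rw [sq]; exact mul_le_mul_of_nonneg_left (not_le.1 h3).le (hP0 X)
    exact sub_le_comm.1 (h1.trans h2)
  · have h1 := measureReal_ne_le_sum q y S hy {X | (if Q X ≤ P X then x else y) = y}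
    have h2 := herr Q {X | (if Q X ≤ P X then x else y) = y} fun X hX => by
      have h3 : Q X ≤ P X := by
        by_contra h3
        exact hX (by simp [h3])
      refine Real.le_sqrt_of_sq_le ?_
      rw [sq]; exact mul_le_mul_of_nonneg_right h3 (hQ0 X)
    exact sub_le_comm.1 (h1.trans h2)

/-- A statistic whose means under `x` and `y` differ by at least `δ` and whose second moments are
at most `V` allows one to distinguish with `8 V δ⁻² log (1 / ε)` traces. -/
theorem canDistinguish_of_statistic (q : unitInterval) {n : ℕ} (x y : BitString n) (T : ℕ)
    {ε V δ : ℝ} (hε : 0 < ε) (hV : 0 < V) (hδ : 0 ≤ δ) (f : List Bool → ℝ)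
    (hδf : δ ≤ |traceExp q (List.ofFn x) f - traceExp q (List.ofFn y) f|)
    (hx : traceExp q (List.ofFn x) (fun t => f t ^ 2) ≤ V)
    (hy : traceExp q (List.ofFn y) (fun t => f t ^ 2) ≤ V)
    (hT : Real.log (1 / ε) * (8 * V) ≤ T * δ ^ 2) : CanDistinguish q x y T ε := by
  classical
  set S : Finset (List Bool) := Finset.univ.image (contract x) ∪ Finset.univ.image (contract y)
  have hSx : ∀ w, contract x w ∈ S := fun w =>
    Finset.mem_union_left _ (Finset.mem_image_of_mem _ (Finset.mem_univ w))
  have hSy : ∀ w, contract y w ∈ S := fun w =>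
    Finset.mem_union_right _ (Finset.mem_image_of_mem _ (Finset.mem_univ w))
  refine canDistinguish_of_pow_le q x y T ε S hSx hSy ?_
  have h1 : ∀ z : BitString n, (∀ w, contract z w ∈ S) →
      ∑ t ∈ S, (traceLaw q z).real {t} = 1 := fun z hz => by
    have := sum_traceLaw_mul q z S hz fun _ => 1
    simpa [traceExp_const] using this
  have h2 := sq_sum_mul_sub_le S (fun t => (traceLaw q x).real {t})
    (fun t => (traceLaw q y).real {t}) f (fun _ => measureReal_nonneg)
    (fun _ => measureReal_nonneg) (h1 x hSx) (h1 y hSy)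
  simp only [sum_traceLaw_mul q x S hSx, sum_traceLaw_mul q y S hSy] at h2
  set ρ := ∑ t ∈ S, √((traceLaw q x).real {t} * (traceLaw q y).real {t})
  have hρ0 : 0 ≤ ρ := Finset.sum_nonneg fun t _ => Real.sqrt_nonneg _
  have hρ1 : ρ ≤ 1 := by
    have : ρ ≤ ∑ t ∈ S, ((traceLaw q x).real {t} + (traceLaw q y).real {t}) / 2 :=
      Finset.sum_le_sum fun t _ => by
        have ha : 0 ≤ (traceLaw q x).real {t} := measureReal_nonneg
        have hb : 0 ≤ (traceLaw q y).real {t} := measureReal_nonneg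
        rw [Real.sqrt_le_left (by positivity)]
        nlinarith [sq_nonneg ((traceLaw q x).real {t} - (traceLaw q y).real {t})]
    rw [← Finset.sum_div, Finset.sum_add_distrib, h1 x hSx, h1 y hSy] at this
    linarith
  have h3 : δ ^ 2 ≤ (1 - ρ) * (8 * V) := by
    calc δ ^ 2 ≤ _ := pow_le_pow_left₀ hδ hδf 2
      _ ≤ _ := by rw [sq_abs]; exact h2
      _ ≤ _ := mul_le_mul_of_nonneg_left (by linarith) (by linarith)
  have h4 : Real.log (1 / ε) ≤ T * (1 - ρ) := by
    have : Real.log (1 / ε) * (8 * V) ≤ T * (1 - ρ) * (8 * V) := by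
      rw [mul_assoc]
      exact hT.trans (mul_le_mul_of_nonneg_left h3 (Nat.cast_nonneg T))
    exact le_of_mul_le_mul_right this (by linarith)
  have h5 : ρ ≤ Real.exp (-(1 - ρ)) := by
    have := Real.add_one_le_exp (-(1 - ρ)); linarith
  calc ρ ^ T ≤ Real.exp (-(1 - ρ)) ^ T := pow_le_pow_left₀ hρ0 h5 T
    _ = Real.exp (T * -(1 - ρ)) := by rw [Real.exp_nat_mul]
    _ ≤ Real.exp (Real.log ε) := by
      rw [Real.exp_le_exp]
      rw [one_div, Real.log_inv] at h4
      linarith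
    _ = ε := Real.exp_log hε

/-! ### Biases and drift of the defect strings. -/

theorem defectList_zero (m : ℕ) :
    defectList 0 m = true :: false :: (List.replicate m [false, true]).flatten := by
  simp [defectList]

theorem defectList_succ (j m : ℕ) : defectList (j + 1) m = false :: true :: defectList j m := by
  simp [defectList, List.replicate_succ]

/-- The value chosen for the empty list is the fixed point of the recursion over one block `01`, so
the end of the string creates no bias. -/
theorem nextMean_alternating {q : ℝ} (h0 : 0 ≤ q) (m : ℕ) :
    nextMean q (List.replicate m [false, true]).flatten = -((1 - q) / (1 + q)) := by
  have : 1 + q ≠ 0 := by positivity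
  induction m with
  | zero => rfl
  | succ m ih =>
    simp only [List.replicate_succ, List.flatten_cons, List.cons_append, List.nil_append, nextMean,
      ih, bitSign_true, bitSign_false]
    field_simp
    ring

theorem pairBias_true_alternating {q : ℝ} (h0 : 0 ≤ q) (m : ℕ) :
    pairBias q true (List.replicate m [false, true]).flatten = 0 := by
  rw [pairBias, nextMean_alternating h0, bitSign_true]; ring

theorem pairBias_false_alternating {q : ℝ} (h0 : 0 ≤ q) (m : ℕ) :
    pairBias q false (true :: (List.replicate m [false, true]).flatten) = 0 := by
  have : 1 + q ≠ 0 := by positivity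
  rw [pairBias, nextMean, nextMean_alternating h0, bitSign_true, bitSign_false]
  field_simp
  ring

theorem drift_alternating {q : ℝ} (h0 : 0 ≤ q) (φ : ℕ → ℝ) (m : ℕ) :
    drift q φ (List.replicate m [false, true]).flatten = 0 := by
  induction m with
  | zero => rfl
  | succ m ih =>
    simp only [List.replicate_succ, List.flatten_cons, List.cons_append, List.nil_append, drift,
      ih, pairBias_true_alternating h0, pairBias_false_alternating h0]
    simp

theorem driftMass_alternating {q : ℝ} (h0 : 0 ≤ q) (m : ℕ) :
    driftMass q (List.replicate m [false, true]).flatten = 0 := by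
  induction m with
  | zero => rfl
  | succ m ih =>
    simp only [List.replicate_succ, List.flatten_cons, List.cons_append, List.nil_append, driftMass,
      ih, pairBias_true_alternating h0, pairBias_false_alternating h0]
    simp

/-- The defect influences the next retained bit only if all `2 * j` bits before it are deleted. -/
theorem nextMean_defectList {q : ℝ} (h0 : 0 ≤ q) (j m : ℕ) :
    nextMean q (defectList j m)
      = -((1 - q) / (1 + q)) + 2 * (1 - q) ^ 2 * q ^ (2 * j) := by
  have : 1 + q ≠ 0 := by positivity
  induction j with
  | zero =>
    simp only [defectList_zero, nextMean, nextMean_alternating h0, bitSign_true, bitSign_false]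
    field_simp
    ring
  | succ j ih =>
    simp only [defectList_succ, nextMean, ih, bitSign_true, bitSign_false]
    field_simp
    ring

theorem pairBias_false_defectList {q : ℝ} (h0 : 0 ≤ q) (j m : ℕ) :
    pairBias q false (true :: defectList j m) = -(q * (2 * (1 - q) ^ 2 * q ^ (2 * j))) := by
  have : 1 + q ≠ 0 := by positivity
  rw [pairBias, nextMean, nextMean_defectList h0, bitSign_true, bitSign_false]
  field_simp
  ring

theorem pairBias_true_defectList {q : ℝ} (h0 : 0 ≤ q) (j m : ℕ) :
    pairBias q true (defectList j m) = 2 * (1 - q) ^ 2 * q ^ (2 * j) := by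
  rw [pairBias, nextMean_defectList h0, bitSign_true]
  ring

theorem pairBias_defect_fst {q : ℝ} (h0 : 0 ≤ q) (m : ℕ) :
    pairBias q true (false :: (List.replicate m [false, true]).flatten)
      = -(2 * (1 - q) * q / (1 + q)) := by
  have : 1 + q ≠ 0 := by positivity
  rw [pairBias, nextMean, nextMean_alternating h0, bitSign_true, bitSign_false]
  field_simp
  ring

theorem pairBias_defect_snd {q : ℝ} (h0 : 0 ≤ q) (m : ℕ) :
    pairBias q false (List.replicate m [false, true]).flatten = 2 * (1 - q) / (1 + q) := by
  rw [pairBias, nextMean_alternating h0, bitSign_false]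
  ring

theorem drift_defectList_succ {q : ℝ} (h0 : 0 ≤ q) (φ : ℕ → ℝ) (j m : ℕ) :
    drift q φ (defectList (j + 1) m) = (lazyStep q ^ 2) (drift q φ (defectList j m))
      + ((1 - q) * (2 * (1 - q) ^ 2 * q ^ (2 * j))) •
        (lazyStep q (fun k => φ (k + 1)) - q • fun k => φ (k + 1)) := by
  rw [defectList_succ]
  simp only [drift, pairBias_false_defectList h0, pairBias_true_defectList h0, map_add, map_smul,
    pow_two, Module.End.mul_apply, smul_sub, smul_smul]
  ext k
  simp only [Pi.add_apply, Pi.sub_apply, Pi.smul_apply, smul_eq_mul]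
  ring

/-- The first summand comes from the two bits of the defect, the `l`-th term of the sum from the
block `01` separated from it by `l` blocks. In each case the earlier bit carries `-q` times the bias
of the later one, which is one walk step further. -/
theorem drift_defectList {q : ℝ} (h0 : 0 ≤ q) (φ : ℕ → ℝ) (j m : ℕ) :
    drift q φ (defectList j m) = (1 - q) •
      ((2 * (1 - q) / (1 + q)) • ((lazyStep q ^ (2 * j + 1)) (fun k => φ (k + 1))
          - q • (lazyStep q ^ (2 * j)) (fun k => φ (k + 1)))
        + ∑ l ∈ Finset.range j, (2 * (1 - q) ^ 2 * q ^ (2 * l)) •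
          ((lazyStep q ^ (2 * (j - 1 - l) + 1)) (fun k => φ (k + 1))
            - q • (lazyStep q ^ (2 * (j - 1 - l))) (fun k => φ (k + 1)))) := by
  induction j with
  | zero =>
    simp only [defectList_zero, drift, drift_alternating h0, pairBias_defect_fst h0,
      pairBias_defect_snd h0]
    ext k
    simp [lazyStep_apply]
    ring
  | succ j ih =>
    rw [drift_defectList_succ h0, ih, Finset.sum_range_succ, map_smul, mul_smul, ← smul_add]
    congr 1
    rw [map_add, map_sum, add_assoc]
    simp only [map_smul, map_sub, ← Module.End.mul_apply, ← pow_add]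
    congr 1
    · rw [show 2 + (2 * j + 1) = 2 * (j + 1) + 1 by ring, show 2 + 2 * j = 2 * (j + 1) by ring]
    · congr 1
      · refine Finset.sum_congr rfl fun l hl => ?_
        have := Finset.mem_range.1 hl
        rw [show 2 + (2 * (j - 1 - l) + 1) = 2 * (j + 1 - 1 - l) + 1 by omega,
          show 2 + 2 * (j - 1 - l) = 2 * (j + 1 - 1 - l) by omega]
      · simp

theorem driftMass_defectList {q : ℝ} (h0 : 0 ≤ q) (h1 : q ≤ 1) (j m : ℕ) :
    driftMass q (defectList j m) ≤ 4 + ∑ l ∈ Finset.range j, 4 * q ^ (2 * l) := by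
  have hq : 0 < 1 + q := by positivity
  have hp : 0 ≤ 1 - q := sub_nonneg.2 h1
  induction j with
  | zero =>
    simp only [defectList_zero, driftMass, driftMass_alternating h0, pairBias_defect_fst h0,
      pairBias_defect_snd h0, abs_neg]
    rw [abs_of_nonneg (by positivity), abs_of_nonneg (by positivity), add_zero, ← add_div,
      div_le_iff₀ hq, Finset.sum_range_zero]
    nlinarith
  | succ j ih =>
    simp only [defectList_succ, driftMass, pairBias_false_defectList h0,
      pairBias_true_defectList h0, abs_neg]
    have hd : 0 ≤ q ^ (2 * j) := by positivity
    have hp2 : (1 - q) ^ 2 ≤ 1 := by nlinarith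
    have h2 : 2 * (1 - q) ^ 2 * q ^ (2 * j) ≤ 2 * q ^ (2 * j) := by nlinarith
    have h3 : 0 ≤ 2 * (1 - q) ^ 2 * q ^ (2 * j) := by positivity
    rw [abs_of_nonneg (by positivity), abs_of_nonneg (by positivity), Finset.sum_range_succ]
    nlinarith

/-! ### The lazy walk and the gap between the two means. -/

/-- `lazyStep q ^ i` averages over a binomial displacement, and the right side is `κ` times its
second moment about `c`: variance plus squared bias. -/
theorem abs_lazyStep_pow_sub_one_le {q : ℝ} (h0 : 0 ≤ q) (h1 : q ≤ 1) {g : ℕ → ℝ} {κ c : ℝ}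
    (hg : ∀ k, |g k - 1| ≤ κ * ((k : ℝ) - c) ^ 2) (i k : ℕ) :
    |(lazyStep q ^ i) g k - 1|
      ≤ κ * (i * ((1 - q) * q) + ((k : ℝ) + i * (1 - q) - c) ^ 2) := by
  induction i generalizing k with
  | zero => simpa using hg k
  | succ i ih =>
    rw [pow_succ', Module.End.mul_apply, lazyStep_apply]
    have hp : 0 ≤ 1 - q := sub_nonneg.2 h1
    have ha := mul_le_mul_of_nonneg_left (ih k) h0
    have hb := mul_le_mul_of_nonneg_left (ih (k + 1)) hp
    rw [← abs_of_nonneg h0, ← abs_mul, abs_of_nonneg h0] at ha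
    rw [← abs_of_nonneg hp, ← abs_mul, abs_of_nonneg hp] at hb
    have h2 := abs_add_le (q * ((lazyStep q ^ i) g k - 1))
      ((1 - q) * ((lazyStep q ^ i) g (k + 1) - 1))
    rw [show q * (lazyStep q ^ i) g k + (1 - q) * (lazyStep q ^ i) g (k + 1) - 1
      = q * ((lazyStep q ^ i) g k - 1) + (1 - q) * ((lazyStep q ^ i) g (k + 1) - 1) by ring]
    refine h2.trans ((add_le_add ha hb).trans (le_of_eq ?_))
    push_cast
    ring

theorem lazyStep_sub_self (q : ℝ) (φ : ℕ → ℝ) :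
    lazyStep q φ - φ = (1 - q) • fun k => φ (k + 1) - φ k := by
  ext k
  simp only [Pi.sub_apply, lazyStep_apply, Pi.smul_apply, smul_eq_mul]
  ring

theorem lazyStep_pow_add_two_sub (q : ℝ) (φ : ℕ → ℝ) (i : ℕ) :
    (lazyStep q ^ (i + 2)) φ - (lazyStep q ^ i) φ
      = (1 - q) • ((lazyStep q ^ (i + 1)) (fun k => φ (k + 1) - φ k)
        + (lazyStep q ^ i) (fun k => φ (k + 1) - φ k)) := by
  rw [smul_add, ← map_smul, ← map_smul, ← lazyStep_sub_self, map_sub, map_sub,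
    ← Module.End.mul_apply, ← Module.End.mul_apply, ← pow_succ, ← pow_succ]
  abel

/-- Two further steps of mean `1 - q` along a slope close to one gain about `2 * (1 - q)`. The
number `l` bounds how far time `i` is from `2 * n`; it enters quadratically, which the geometric
biases will absorb. -/
theorem abs_two_step_sub_le {q : ℝ} (h0 : 0 ≤ q) (h1 : q ≤ 1) {φ : ℕ → ℝ} {κ : ℝ} (hκ : 0 ≤ κ)
    {n : ℕ} (hφ : ∀ k, |φ (k + 1) - φ k - 1| ≤ κ * ((k : ℝ) - 2 * n * (1 - q)) ^ 2) {i l : ℕ}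
    (hi : i + 1 ≤ 2 * n) (hl : 2 * n ≤ i + l) (hn : 1 ≤ n) :
    |((lazyStep q ^ (i + 2)) φ - (lazyStep q ^ i) φ) 0 - 2 * (1 - q)|
      ≤ κ * n * (4 + 2 * (l : ℝ) ^ 2) := by
  have hp : 0 ≤ 1 - q := sub_nonneg.2 h1
  have hstep : ∀ r : ℕ, r ≤ 2 * n → 2 * n ≤ r + l →
      |(lazyStep q ^ r) (fun k => φ (k + 1) - φ k) 0 - 1| ≤ κ * n * (2 + (l : ℝ) ^ 2) := by
    intro r hr hrl
    refine (abs_lazyStep_pow_sub_one_le h0 h1 hφ r 0).trans ?_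
    rw [mul_assoc κ]
    refine mul_le_mul_of_nonneg_left ?_ hκ
    have hr' : (r : ℝ) ≤ 2 * n := by exact_mod_cast hr
    have hrl' : (2 * n : ℝ) ≤ r + l := by exact_mod_cast hrl
    have hn' : (1 : ℝ) ≤ n := by exact_mod_cast hn
    have h2 : (r : ℝ) * ((1 - q) * q) ≤ 2 * n := by
      have : (1 - q) * q ≤ 1 := by nlinarith
      nlinarith [mul_le_mul_of_nonneg_left this (Nat.cast_nonneg (α := ℝ) r)]
    have h3 : (((0 : ℕ) : ℝ) + r * (1 - q) - 2 * n * (1 - q)) ^ 2 ≤ (l : ℝ) ^ 2 := by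
      rw [Nat.cast_zero, show (0 : ℝ) + r * (1 - q) - 2 * n * (1 - q)
        = -((2 * n - r) * (1 - q)) by ring, neg_sq]
      refine pow_le_pow_left₀ (mul_nonneg (by linarith) hp) ?_ 2
      calc (2 * n - r) * (1 - q) ≤ (2 * n - r) * 1 :=
            mul_le_mul_of_nonneg_left (by linarith) (by linarith)
        _ ≤ l := by linarith
    nlinarith [sq_nonneg (l : ℝ)]
  have ha := hstep i (by omega) hl
  have hb := hstep (i + 1) hi (by omega)
  rw [lazyStep_pow_add_two_sub]
  simp only [Pi.smul_apply, Pi.add_apply, smul_eq_mul]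
  set u := (lazyStep q ^ i) (fun k => φ (k + 1) - φ k) 0
  set v := (lazyStep q ^ (i + 1)) (fun k => φ (k + 1) - φ k) 0
  rw [show (1 - q) * (v + u) - 2 * (1 - q) = (1 - q) * ((v - 1) + (u - 1)) by ring, abs_mul,
    abs_of_nonneg hp]
  calc (1 - q) * |(v - 1) + (u - 1)| ≤ 1 * |(v - 1) + (u - 1)| :=
        mul_le_mul_of_nonneg_right (by linarith) (abs_nonneg _)
    _ ≤ |v - 1| + |u - 1| := by rw [one_mul]; exact abs_add_le _ _
    _ ≤ _ := by linarith

/-- Moving the defect by two positions changes the expected statistic by a constant. -/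
theorem drift_defectList_sub_ge {q : ℝ} (h0 : 0 ≤ q) (h1 : q ≤ 1) {φ : ℕ → ℝ} {κ B : ℝ}
    (hκ : 0 ≤ κ) {n : ℕ} (hn : 1 ≤ n) (h1φ : φ 1 = 0) (h2φ : φ 2 = 0)
    (hφ : ∀ k : ℕ, |φ (k + 2) - φ (k + 1) - 1| ≤ κ * ((k : ℝ) - 2 * n * (1 - q)) ^ 2)
    (hB : ∀ j, 144 + ∑ l ∈ Finset.range j, 4 * q ^ (2 * l) * (4 + 2 * (2 * (l : ℝ) + 4) ^ 2) ≤ B)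
    (hκB : κ * n * B ≤ (1 - q) ^ 3) (m m' : ℕ) :
    (1 - q) ^ 4 ≤ drift q φ (defectList n m) 0 - drift q φ (defectList (n - 1) m') 0 := by
  obtain ⟨j, rfl⟩ : ∃ j, n = j + 1 := ⟨n - 1, by omega⟩
  have hp : 0 ≤ 1 - q := sub_nonneg.2 h1
  have hp1 : 1 - q ≤ 1 := by linarith
  have hq : 0 < 1 + q := by positivity
  set ψ : ℕ → ℝ := fun k => φ (k + 1) with hψ
  set e : ℕ → ℝ := fun i => ((lazyStep q ^ (i + 2)) ψ - (lazyStep q ^ i) ψ) 0 with he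
  set N : ℝ := ((j + 1 : ℕ) : ℝ) with hN
  have hN0 : 0 ≤ N := Nat.cast_nonneg _
  set w : ℕ → ℝ := fun l => κ * N * (4 + 2 * (2 * (l : ℝ) + 4) ^ 2) with hw
  have hbound : ∀ i l : ℕ, i + 1 ≤ 2 * (j + 1) → 2 * (j + 1) ≤ i + (2 * l + 4) →
      |e i - 2 * (1 - q)| ≤ w l := fun i l hi hl => by
    have := abs_two_step_sub_le h0 h1 hκ (φ := ψ) hφ hi hl hn
    rwa [show ((2 * l + 4 : ℕ) : ℝ) = 2 * l + 4 by push_cast; rfl] at this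
  have hterm : ∀ i l : ℕ, i + 2 ≤ 2 * (j + 1) → 2 * (j + 1) ≤ i + (2 * l + 4) →
      2 * (1 - q) ^ 2 - 2 * w l ≤ e (i + 1) - q * e i := fun i l hi hl => by
    have ha := abs_le.1 (hbound i l (by omega) hl)
    have hb := abs_le.1 (hbound (i + 1) l hi (by omega))
    have hw0 : 0 ≤ w l := (abs_nonneg _).trans (hbound i l (by omega) hl)
    nlinarith
  have hexp : drift q φ (defectList (j + 1) m) 0 - drift q φ (defectList j m') 0
      = (1 - q) * (2 * (1 - q) / (1 + q) * (e (2 * j + 1) - q * e (2 * j))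
        + ∑ l ∈ Finset.range j, 2 * (1 - q) ^ 2 * q ^ (2 * l) *
          (e (2 * (j - 1 - l) + 1) - q * e (2 * (j - 1 - l)))) := by
    -- The longer prefix has one extra leading block; its contribution vanishes because `φ` is zero
    -- at ranks 1 and 2.
    have hz : lazyStep q ψ 0 - q * ψ 0 = 0 := by
      simp only [lazyStep_apply, hψ, zero_add, h1φ, h2φ]; ring
    have hD : drift q φ (defectList j m) = drift q φ (defectList j m') := by
      rw [drift_defectList h0, drift_defectList h0]
    rw [drift_defectList_succ h0, hD, Pi.add_apply, Pi.smul_apply, Pi.sub_apply, Pi.smul_apply,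
      smul_eq_mul, smul_eq_mul, hz, mul_zero, add_zero, drift_defectList h0]
    simp only [map_smul, map_add, map_sum, map_sub, ← Module.End.mul_apply, ← pow_add]
    simp only [Pi.smul_apply, Pi.add_apply, Pi.sub_apply, smul_eq_mul, Finset.sum_apply, he, ← hψ]
    rw [← mul_sub, add_sub_add_comm, ← Finset.sum_sub_distrib]
    congr 2
    · rw [add_comm 2, add_comm 2]; ring
    · refine Finset.sum_congr rfl fun l _ => ?_
      rw [add_comm 2, add_comm 2]; ring
  rw [Nat.add_sub_cancel, hexp]
  have hbase := hterm (2 * j) 0 (by omega) (by omega)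
  -- The main parts of these terms are nonnegative and are dropped; the defect's own pairs already
  -- give the gap.
  have hsum : -∑ l ∈ Finset.range j, 4 * q ^ (2 * l) * w l
      ≤ ∑ l ∈ Finset.range j, 2 * (1 - q) ^ 2 * q ^ (2 * l) *
          (e (2 * (j - 1 - l) + 1) - q * e (2 * (j - 1 - l))) := by
    rw [← Finset.sum_neg_distrib]
    refine Finset.sum_le_sum fun l hl => ?_
    have hl' := Finset.mem_range.1 hl
    have h3 := hterm (2 * (j - 1 - l)) l (by omega) (by omega)
    have hw0 : 0 ≤ w l := by positivity
    have hd : 0 ≤ q ^ (2 * l) := by positivity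
    have hp2 : (1 - q) ^ 2 ≤ 1 := by nlinarith
    have h4 : -(2 * w l) ≤ e (2 * (j - 1 - l) + 1) - q * e (2 * (j - 1 - l)) := by
      nlinarith [sq_nonneg (1 - q)]
    have h5 := mul_le_mul_of_nonneg_left h4
      (show 0 ≤ 2 * (1 - q) ^ 2 * q ^ (2 * l) by positivity)
    have h6 : 2 * (1 - q) ^ 2 * q ^ (2 * l) * (2 * w l) ≤ 4 * q ^ (2 * l) * w l := by
      have := mul_le_mul_of_nonneg_right hp2 (mul_nonneg hd hw0)
      linarith
    linarith
  have hfrac : 2 * (1 - q) / (1 + q) ≤ 2 := by rw [div_le_iff₀ hq]; nlinarith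
  have hfrac' : 1 - q ≤ 2 * (1 - q) / (1 + q) := by rw [le_div_iff₀ hq]; nlinarith
  have hw0 : w 0 = 36 * (κ * N) := by simp only [hw]; push_cast; ring
  -- Here `144 = 2 * 2 * 36`: the prefactor is at most 2 and the error is `2 * w 0`.
  have hb2 : 2 * (1 - q) ^ 3 - 144 * (κ * N)
      ≤ 2 * (1 - q) / (1 + q) * (e (2 * j + 1) - q * e (2 * j)) := by
    have h3 := mul_le_mul_of_nonneg_left hbase (hp.trans hfrac')
    have h4 := mul_le_mul_of_nonneg_right hfrac' (sq_nonneg (1 - q))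
    have h5 := mul_le_mul_of_nonneg_right hfrac (show 0 ≤ w 0 by positivity)
    rw [hw0] at h3 h5
    nlinarith
  have hBj := mul_le_mul_of_nonneg_left (hB j) (mul_nonneg hκ hN0)
  have hws : ∑ l ∈ Finset.range j, 4 * q ^ (2 * l) * w l = κ * N *
      ∑ l ∈ Finset.range j, 4 * q ^ (2 * l) * (4 + 2 * (2 * (l : ℝ) + 4) ^ 2) := by
    rw [Finset.mul_sum]
    exact Finset.sum_congr rfl fun l _ => by simp only [hw]; ring
  rw [pow_succ' (1 - q) 3]
  refine mul_le_mul_of_nonneg_left ?_ hp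
  linarith

/-! ### The tent weight. -/

/-- The tent function with apex `a` and half-width `L`. -/
noncomputable def tent (a L : ℝ) (k : ℕ) : ℝ := max 0 (L - |(k : ℝ) - a|)

theorem tent_nonneg (a L : ℝ) (k : ℕ) : 0 ≤ tent a L k := le_max_left _ _

theorem tent_le {a L : ℝ} (hL : 0 ≤ L) (k : ℕ) : tent a L k ≤ L :=
  max_le hL (by linarith [abs_nonneg ((k : ℝ) - a)])

theorem tent_eq_zero {a L : ℝ} {k : ℕ} (h : L ≤ |(k : ℝ) - a|) : tent a L k = 0 :=
  max_eq_left (by linarith)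

theorem abs_tent_sub_le (a L : ℝ) (k : ℕ) : |tent a L (k + 1) - tent a L k| ≤ 1 := by
  have h := abs_max_sub_max_le_abs (L - |((k + 1 : ℕ) : ℝ) - a|) (L - |(k : ℝ) - a|) 0
  rw [max_comm _ 0, max_comm _ 0] at h
  refine h.trans ?_
  rw [show L - |((k + 1 : ℕ) : ℝ) - a| - (L - |(k : ℝ) - a|)
    = |(k : ℝ) - a| - |((k + 1 : ℕ) : ℝ) - a| by ring]
  refine (abs_abs_sub_abs_le _ _).trans ?_
  push_cast
  norm_num

theorem tent_sub_eq_one {a L : ℝ} {k : ℕ} (h1 : a - L ≤ k) (h2 : (k : ℝ) + 1 ≤ a) :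
    tent a L (k + 1) - tent a L k = 1 := by
  rw [tent, tent, abs_of_nonpos (by push_cast; linarith), abs_of_nonpos (by linarith),
    max_eq_right (by push_cast; linarith), max_eq_right (by linarith)]
  push_cast
  ring

/-- With the apex at `c + L / 2`, the slope is exactly one within `L / 4` of `c`, where `8 ≤ L`
leaves room for the shift by two. Elsewhere the error is at most `2 = 32 / L ^ 2 * (L / 4) ^ 2`. -/
theorem abs_tent_slope_sub_one_le {c L : ℝ} (hL : 8 ≤ L) (k : ℕ) :
    |tent (c + L / 2) L (k + 2) - tent (c + L / 2) L (k + 1) - 1|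
      ≤ 32 / L ^ 2 * ((k : ℝ) - c) ^ 2 := by
  by_cases h : |(k : ℝ) - c| ≤ L / 4
  · have := abs_le.1 h
    rw [tent_sub_eq_one (k := k + 1) (by push_cast; linarith) (by push_cast; linarith)]
    simp only [sub_self, abs_zero]
    positivity
  · have h2 := abs_tent_sub_le (c + L / 2) L (k + 1)
    have h3 : |tent (c + L / 2) L (k + 2) - tent (c + L / 2) L (k + 1) - 1| ≤ 2 := by
      have := abs_le.1 h2
      rw [abs_le]
      constructor <;> linarith
    have h4 : (L / 4) ^ 2 ≤ ((k : ℝ) - c) ^ 2 := by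
      rw [← sq_abs ((k : ℝ) - c)]
      exact pow_le_pow_left₀ (by linarith) (not_le.1 h).le 2
    refine h3.trans ?_
    rw [div_mul_eq_mul_div, le_div_iff₀ (by positivity)]
    linarith

theorem sum_tent_le {a L : ℝ} (hL : 0 ≤ L) (haL : L ≤ a) (J : ℕ) :
    ∑ k ∈ Finset.range J, tent a L k ≤ (2 * L + 1) * L := by
  have hsub : ∀ k ∈ Finset.range J, k ∉ Finset.Icc ⌈a - L⌉₊ ⌊a + L⌋₊ → tent a L k = 0 := by
    intro k _ hk
    refine tent_eq_zero ?_
    by_contra! h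
    have := abs_lt.1 h
    refine hk (Finset.mem_Icc.2 ⟨Nat.ceil_le.2 (by linarith), Nat.le_floor (by linarith)⟩)
  have h1 : ∑ k ∈ Finset.range J, tent a L k
      ≤ ∑ k ∈ Finset.Icc ⌈a - L⌉₊ ⌊a + L⌋₊, tent a L k := by
    rw [← Finset.sum_filter_of_ne (p := fun k => k ∈ Finset.Icc ⌈a - L⌉₊ ⌊a + L⌋₊)
      fun k hk hne => by_contra fun hn => hne (hsub k hk hn)]
    exact Finset.sum_le_sum_of_subset_of_nonneg (fun k hk => (Finset.mem_filter.1 hk).2)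
      fun k _ _ => tent_nonneg a L k
  refine h1.trans ((Finset.sum_le_card_nsmul _ _ L fun k _ => tent_le hL k).trans ?_)
  rw [nsmul_eq_mul]
  refine mul_le_mul_of_nonneg_right ?_ hL
  rw [Nat.card_Icc]
  have h2 : (⌊a + L⌋₊ : ℝ) ≤ a + L := Nat.floor_le (by linarith)
  have h3 : a - L ≤ ⌈a - L⌉₊ := Nat.le_ceil _
  rcases le_total ⌈a - L⌉₊ (⌊a + L⌋₊ + 1) with h | h
  · rw [Nat.cast_sub h]; push_cast; linarith
  · rw [Nat.sub_eq_zero_of_le h]; push_cast; linarith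

theorem traceExp_sq_pairStat_tent_le {q : ℝ} (h0 : 0 ≤ q) (h1 : q ≤ 1) {a L m : ℝ} (hL : 1 ≤ L)
    (haL : L ≤ a) (l : List Bool) (hm : driftMass q l ≤ m) :
    traceExp q l (fun t => pairStat q (tent a L) 0 0 t ^ 2) ≤ (36 + 12 * m) * L ^ 3 := by
  have hL0 : 0 ≤ L := by linarith
  have hm0 : 0 ≤ m := (driftMass_nonneg q l).trans hm
  set J := ⌈a + L⌉₊
  have hw : 0 ≤ (12 + 4 * m) * L := by positivity
  have key := traceExp_sq_pairStat_le h0 h1 (φ := tent a L) (L := L) (m := m)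
    -- Tail sums cut off at `J`, beyond the support of the tent, satisfy the recursion for every
    -- `k`.
    (G := fun k => (12 + 4 * m) * L * ∑ j ∈ Finset.Ico k J, tent a L j) (tent_nonneg a L)
    (tent_le hL0) (fun k => mul_nonneg hw (Finset.sum_nonneg fun j _ => tent_nonneg a L j))
    (fun k => by
      rw [← mul_add]
      congr 1
      rcases lt_or_ge k J with hk | hk
      · exact Finset.sum_eq_sum_Ico_succ_bot hk _
      · rw [Finset.Ico_eq_empty_of_le hk, Finset.Ico_eq_empty_of_le (hk.trans (Nat.le_succ k)),
          tent_eq_zero]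
        · simp
        · have : a + L ≤ k := (Nat.le_ceil _).trans (by exact_mod_cast hk)
          exact le_trans (by linarith) (le_abs_self _))
    l hm 0 0 (by simp)
  refine key.trans ?_
  simp only [← Finset.range_eq_Ico]
  refine (mul_le_mul_of_nonneg_left (sum_tent_le hL0 haL J) hw).trans ?_
  have : (2 * L + 1) * L ≤ 3 * L * L := by nlinarith
  calc _ ≤ (12 + 4 * m) * L * (3 * L * L) := mul_le_mul_of_nonneg_left this hw
    _ = _ := by ring

theorem exists_weighted_geometric_bound {q : ℝ} (h0 : 0 ≤ q) (h1 : q < 1) :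
    ∃ B : ℝ, ∀ j,
      144 + ∑ l ∈ Finset.range j, 4 * q ^ (2 * l) * (4 + 2 * (2 * (l : ℝ) + 4) ^ 2) ≤ B := by
  have hq2 : ‖q ^ 2‖ < 1 := by
    rw [Real.norm_eq_abs, abs_of_nonneg (sq_nonneg q)]
    nlinarith
  have hs : Summable fun l : ℕ => 4 * q ^ (2 * l) * (4 + 2 * (2 * (l : ℝ) + 4) ^ 2) := by
    have h := (((summable_pow_mul_geometric_of_norm_lt_one 0 hq2).mul_left 144).add
      ((summable_pow_mul_geometric_of_norm_lt_one 1 hq2).mul_left 128)).add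
      ((summable_pow_mul_geometric_of_norm_lt_one 2 hq2).mul_left 32)
    refine h.congr fun l => ?_
    rw [← pow_mul]
    ring
  refine ⟨144 + ∑' l : ℕ, 4 * q ^ (2 * l) * (4 + 2 * (2 * (l : ℝ) + 4) ^ 2), fun j => ?_⟩
  have := hs.sum_le_tsum (Finset.range j) fun l _ => by positivity
  linarith

/-! ### Choice of the statistic for large and for small `n`. -/

theorem exists_statistic {q : ℝ} (h0 : 0 ≤ q) (h1 : q < 1) :
    ∃ V : ℝ, 0 < V ∧ ∃ N : ℕ, ∀ n : ℕ, 1 ≤ n → N ≤ n → ∃ f : List Bool → ℝ,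
      (1 - q) ^ 4 ≤ traceExp q (defectList n (n - 1)) f - traceExp q (defectList (n - 1) n) f ∧
      traceExp q (defectList (n - 1) n) (fun t => f t ^ 2) ≤ V * (n : ℝ) ^ (3 / 2 : ℝ) ∧
      traceExp q (defectList n (n - 1)) (fun t => f t ^ 2) ≤ V * (n : ℝ) ^ (3 / 2 : ℝ) := by
  have hp : 0 < 1 - q := sub_pos.2 h1
  obtain ⟨B, hB⟩ := exists_weighted_geometric_bound h0 h1
  have hB144 : 144 ≤ B := by simpa using hB 0
  -- With `L ^ 2 = K * n` and `κ = 32 / L ^ 2`, this value makes `κ * n * B` equal to `(1 - q) ^ 3`.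
  set K : ℝ := 32 * B / (1 - q) ^ 3 with hK
  have hK64 : 64 ≤ K := by
    rw [hK, le_div_iff₀ (by positivity)]
    have : (1 - q) ^ 3 ≤ 1 := pow_le_one₀ hp.le (by linarith)
    linarith
  have hK0 : 0 < K := by linarith
  have hmass : ∀ j m, driftMass q (defectList j m) ≤ B := fun j m => by
    refine (driftMass_defectList h0 h1.le j m).trans (le_trans ?_ (hB j))
    refine add_le_add (by norm_num) (Finset.sum_le_sum fun l _ => ?_)
    refine le_mul_of_one_le_right (by positivity) ?_
    nlinarith [sq_nonneg (2 * (l : ℝ) + 4)]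
  refine ⟨(36 + 12 * B) * K ^ (3 / 2 : ℝ), by positivity,
    -- The second bound gives `L ≤ 2 * (1 - q) * n`, so the left foot of the tent is at least `n *
    -- (1 - q)`, which the first bound makes at least 2.
    ⌈max (2 / (1 - q)) (K / (4 * (1 - q) ^ 2))⌉₊, fun n hn hNn => ?_⟩
  have hn1 : (1 : ℝ) ≤ n := by exact_mod_cast hn
  have hn0 : (0 : ℝ) < n := by linarith
  have hNn' := Nat.ceil_le.1 hNn
  have hn2 : 2 ≤ n * (1 - q) := by
    have h2 := le_max_left (2 / (1 - q)) (K / (4 * (1 - q) ^ 2))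
    rw [← div_le_iff₀ hp]
    linarith
  have hn3 : K ≤ 4 * (1 - q) ^ 2 * n := by
    have h2 := le_max_right (2 / (1 - q)) (K / (4 * (1 - q) ^ 2))
    rw [mul_comm, ← div_le_iff₀ (by positivity)]
    linarith
  set L : ℝ := √(K * n) with hLdef
  have hL2 : L ^ 2 = K * n := Real.sq_sqrt (by positivity)
  have hL8 : 8 ≤ L := Real.le_sqrt_of_sq_le (by nlinarith)
  have hLn : L ≤ 2 * (1 - q) * n := by
    rw [hLdef, Real.sqrt_le_left (by positivity)]
    nlinarith
  have hL3 : L ^ 3 = K ^ (3 / 2 : ℝ) * (n : ℝ) ^ (3 / 2 : ℝ) := by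
    rw [← Real.mul_rpow hK0.le hn0.le, hLdef, Real.sqrt_eq_rpow, ← Real.rpow_natCast,
      ← Real.rpow_mul (by positivity)]
    norm_num
  set a : ℝ := 2 * n * (1 - q) + L / 2 with ha
  have hφz : ∀ k : ℕ, (k : ℝ) ≤ 2 → tent a L k = 0 := fun k hk => by
    refine tent_eq_zero (le_trans ?_ (neg_le_abs _))
    linarith
  -- The fictitious bit at rank 0 has weight zero, so the initial pair does not count.
  have hmean : ∀ l, traceExp q l (pairStat q (tent a L) 0 0) = drift q (tent a L) l 0 := fun l => by
    rw [traceExp_pairStat, hφz 0 (by norm_num), zero_mul, zero_add]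
  have hsq : ∀ j m, traceExp q (defectList j m) (fun t => pairStat q (tent a L) 0 0 t ^ 2)
      ≤ (36 + 12 * B) * K ^ (3 / 2 : ℝ) * (n : ℝ) ^ (3 / 2 : ℝ) := fun j m => by
    rw [mul_assoc, ← hL3]
    exact traceExp_sq_pairStat_tent_le h0 h1.le (by linarith) (by linarith) _ (hmass j m)
  refine ⟨pairStat q (tent a L) 0 0, ?_, hsq _ _, hsq _ _⟩
  rw [hmean, hmean]
  refine drift_defectList_sub_ge h0 h1.le (κ := 32 / L ^ 2) (B := B) (by positivity) hn
    (hφz 1 (by norm_num)) (hφz 2 (by norm_num)) (fun k => abs_tent_slope_sub_one_le hL8 k) hB ?_ _ _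
  rw [hL2, hK]
  apply le_of_eq
  field_simp

theorem defectList_ne (j m : ℕ) : defectList j (m + 1) ≠ defectList (j + 1) m := by
  induction j with
  | zero => simp [defectList_zero, defectList_succ]
  | succ j ih =>
    rw [defectList_succ j, defectList_succ (j + 1)]
    simpa using ih

theorem ofFn_xString (n : ℕ) (hn : 1 ≤ n) : List.ofFn (xString n hn) = defectList (n - 1) n := by
  refine List.ext_getElem (by rw [List.length_ofFn, length_defectList]; omega) fun i h1 h2 => ?_
  simp [xString]

theorem ofFn_yString (n : ℕ) (hn : 1 ≤ n) : List.ofFn (yString n hn) = defectList n (n - 1) := by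
  refine List.ext_getElem (by rw [List.length_ofFn, length_defectList]; omega) fun i h1 h2 => ?_
  simp [yString]

/-- A trace equals the first string if nothing is deleted. It is never a trace of the second, a
different string of the same length. -/
theorem exists_indicator_statistic {q : ℝ} (h0 : 0 ≤ q) (h1 : q < 1) {n : ℕ} (hn : 1 ≤ n) :
    ∃ f : List Bool → ℝ,
      (1 - q) ^ (4 * n)
        ≤ |traceExp q (defectList (n - 1) n) f - traceExp q (defectList n (n - 1)) f| ∧
      ∀ l, traceExp q l (fun t => f t ^ 2) ≤ 1 := by
  have hlen : (defectList (n - 1) n).length = 4 * n := by rw [length_defectList]; omega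
  have hlen' : (defectList n (n - 1)).length = 4 * n := by rw [length_defectList]; omega
  refine ⟨fun t => if t = defectList (n - 1) n then 1 else 0, ?_, fun l => ?_⟩
  · rw [traceExp_eq_zero_of_sublist q (defectList n (n - 1)), sub_zero]
    · rw [← hlen]
      exact (pow_length_le_traceExp_indicator h0 h1.le _).trans (le_abs_self _)
    · intro t ht
      refine if_neg fun h => ?_
      subst h
      have h2 := ht.eq_of_length (hlen.trans hlen'.symm)
      obtain ⟨m, rfl⟩ : ∃ m, n = m + 1 := ⟨n - 1, by omega⟩
      exact defectList_ne m m h2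
  · have h2 := traceExp_nonneg h0 h1.le l
      (F := fun t => 1 + -1 * (if t = defectList (n - 1) n then (1 : ℝ) else 0) ^ 2)
      fun t => by split_ifs <;> norm_num
    rw [traceExp_add, traceExp_const_mul, traceExp_const] at h2
    linarith

end TraceReconstruction

theorem proposition2 (q : unitInterval) (hq0 : 0 < q) (hq1 : q < 1) :
    ∃ C : ℝ, 0 < C ∧ ∀ ε : ℝ, 0 < ε → ε < 1 / 2 → ∀ (n : ℕ) (hn : 2 ≤ n),
      TraceReconstruction.CanDistinguish q
        (TraceReconstruction.xString n (Nat.le_of_succ_le hn))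
        (TraceReconstruction.yString n (Nat.le_of_succ_le hn))
        ⌈C * Real.log (1 / ε) * (n : ℝ) ^ (3 / 2 : ℝ) * Real.log n⌉₊ ε := by
  have h0 : (0 : ℝ) ≤ q := hq0.le
  have h1 : (q : ℝ) < 1 := hq1
  have hp : 0 < 1 - (q : ℝ) := sub_pos.2 h1
  have hp1 : 1 - (q : ℝ) ≤ 1 := by linarith
  have hlog2 : 0 < Real.log 2 := Real.log_pos one_lt_two
  obtain ⟨V, hV, N, hN⟩ := TraceReconstruction.exists_statistic h0 h1
  -- This lies below both gaps: `(1 - q) ^ 4` for `n ≥ N` and `(1 - q) ^ (4 * n)` for `n ≤ N`.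
  set δ : ℝ := (1 - (q : ℝ)) ^ (4 * N + 4) with hδ
  have hδ0 : 0 < δ := by positivity
  have hVpos : 0 < max V 1 := lt_max_of_lt_left hV
  refine ⟨8 * max V 1 / (δ ^ 2 * Real.log 2), by positivity, fun ε hε hε2 n hn => ?_⟩
  have hn1 : 1 ≤ n := Nat.le_of_succ_le hn
  have hn2 : (2 : ℝ) ≤ n := by exact_mod_cast hn
  have hpow : 1 ≤ (n : ℝ) ^ (3 / 2 : ℝ) := Real.one_le_rpow (by linarith) (by norm_num)
  have hlogε : 0 ≤ Real.log (1 / ε) := Real.log_nonneg (by rw [le_div_iff₀ hε]; linarith)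
  have hlogn : Real.log 2 ≤ Real.log n := Real.log_le_log two_pos hn2
  have hstat : ∃ f : List Bool → ℝ,
      δ ≤ |TraceReconstruction.traceExp q (TraceReconstruction.defectList (n - 1) n) f
        - TraceReconstruction.traceExp q (TraceReconstruction.defectList n (n - 1)) f| ∧
      TraceReconstruction.traceExp q (TraceReconstruction.defectList (n - 1) n)
        (fun t => f t ^ 2) ≤ max V 1 * (n : ℝ) ^ (3 / 2 : ℝ) ∧
      TraceReconstruction.traceExp q (TraceReconstruction.defectList n (n - 1))
        (fun t => f t ^ 2) ≤ max V 1 * (n : ℝ) ^ (3 / 2 : ℝ) := by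
    rcases le_total N n with h | h
    · obtain ⟨f, hf, hfx, hfy⟩ := hN n hn1 h
      have hle := mul_le_mul_of_nonneg_right (le_max_left V 1) (zero_le_one.trans hpow)
      refine ⟨f, ?_, hfx.trans hle, hfy.trans hle⟩
      rw [abs_sub_comm]
      exact (pow_le_pow_of_le_one hp.le hp1 (by omega)).trans (hf.trans (le_abs_self _))
    · obtain ⟨f, hf, hf2⟩ := TraceReconstruction.exists_indicator_statistic h0 h1 hn1
      have hle : 1 ≤ max V 1 * (n : ℝ) ^ (3 / 2 : ℝ) :=
        one_le_mul_of_one_le_of_one_le (le_max_right V 1) hpow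
      exact ⟨f, (pow_le_pow_of_le_one hp.le hp1 (by omega)).trans hf, (hf2 _).trans hle,
        (hf2 _).trans hle⟩
  obtain ⟨f, hf, hfx, hfy⟩ := hstat
  refine TraceReconstruction.canDistinguish_of_statistic q _ _ _ hε
    (V := max V 1 * (n : ℝ) ^ (3 / 2 : ℝ)) (by positivity) hδ0.le f ?_ ?_ ?_ ?_
  · rwa [TraceReconstruction.ofFn_xString, TraceReconstruction.ofFn_yString]
  · rwa [TraceReconstruction.ofFn_xString]
  · rwa [TraceReconstruction.ofFn_yString]
  · refine le_trans ?_ (mul_le_mul_of_nonneg_right (Nat.le_ceil _) (sq_nonneg δ))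
    have hrw : 8 * max V 1 / (δ ^ 2 * Real.log 2) * Real.log (1 / ε) * (n : ℝ) ^ (3 / 2 : ℝ)
        * Real.log n * δ ^ 2 = Real.log (1 / ε) * (8 * (max V 1 * (n : ℝ) ^ (3 / 2 : ℝ)))
          * (Real.log n / Real.log 2) := by
      field_simp
    rw [hrw]
    -- The factor `log n` is needed only to be at least `log 2`; the argument itself uses order `n ^
    -- (3 / 2)` traces.
    refine le_mul_of_one_le_right (by positivity) ?_
    rwa [le_div_iff₀ hlog2, one_mul]
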